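/- Let $d\in\mathbb{N}$ and let $f,g\in L^2(\mathbb{R}^d)$ be complex-valued. Their Wigner distribution is $$W(f,g)(x,\xi)=\int_{\mathbb{R}^d} f\left(x+\tfrac t2\right)\overline{g\left(x-\tfrac t2\right)}\,e^{-2\pi i\langle \xi,t\rangle}\,dt,\qquad (x,\xi)\in\mathbb{R}^{2d}.$$ A generalized Gaussian is a function $\gamma\in L^2(\mathbb{R}^d)$ of the form $\gamma=e^{-q}$ (almost everywhere), where $q$ is a polynomial of degree at most $2$ on $\mathbb{R}^d$ with complex coefficients. (i) If $\operatorname{Re}W(f,g)(x,\xi)\neq 0$ for all $(x,\xi)\in\mathbb{R}^{2d}$, then there are a generalized Gaussian $\gamma$ and constants $a,b\in\mathbb{C}$ such that $f=a\gamma$ and $g=b\gamma$. (ii) If $\operatorname{Im}W(f,g)(x,\xi)\neq 0$ for all $(x,\xi)\in\mathbb{R}^{2d}$, then both $f$ and $g$ are generalized Gaussians. -/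

import Mathlib

open MeasureTheory
open scoped ENNReal ComplexConjugate

noncomputable section

/-- The Hilbert space `L²(ℝᵈ)` of (classes of) complex-valued square-integrable functions,
with respect to Lebesgue measure. -/
abbrev L2 (d : ℕ) : Type :=
  Lp ℂ 2 (volume : Measure (EuclideanSpace ℝ (Fin d)))

/-- The (cross-)Wigner distribution
`W(f,g)(x,ξ) = ∫ f(x + t/2) conj(g(x - t/2)) exp(-2πi⟨ξ,t⟩) dt`.
For square-integrable `f` and `g` the integral converges absolutely for every `(x,ξ)` by
the Cauchy-Schwarz inequality, and its value does not depend on the representatives. -/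
def wigner {d : ℕ} (f g : L2 d) (x ξ : EuclideanSpace ℝ (Fin d)) : ℂ :=
  ∫ t : EuclideanSpace ℝ (Fin d),
    f (x + (1 / 2 : ℝ) • t) * conj (g (x - (1 / 2 : ℝ) • t)) *
      Complex.exp (-2 * (Real.pi : ℂ) * Complex.I * ((inner ℝ ξ t : ℝ) : ℂ))

/-- `γ ∈ L²(ℝᵈ)` is a generalized Gaussian if `γ = exp(-q)` for a polynomial `q` of degree
at most two in the coordinates, with complex coefficients. -/
def IsGeneralizedGaussian {d : ℕ} (γ : L2 d) : Prop :=
  ∃ q : MvPolynomial (Fin d) ℂ, q.totalDegree ≤ 2 ∧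
    ∀ᵐ x : EuclideanSpace ℝ (Fin d),
      γ x = Complex.exp (-MvPolynomial.eval (fun i => (x i : ℂ)) q)

end

/-! The idea is to smooth the Wigner distribution into a product of two entire functions, and then
use zero-freeness and Liouville's theorem.

Suppose `Re (c W(f,g))` never vanishes; `c = 1` and `c = -i` give the two parts of the theorem. By
continuity it has constant sign, and replacing `c` by `-c` makes it positive. Let `F` and `G` be the
Fourier–Laplace transforms of `f` and `g` multiplied by `exp(-π‖s‖²)`, that is, their Bargmann
transforms up to Gaussian factors. At every phase-space point, `F * conj G` is an integral of
`W(f,g)` against a positive Gaussian weight, so `Re (c F conj G) > 0`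
(`re_bargmann_mul_conj_bargmann_pos`).

In particular `F` and `G` have no zeros. On each complexified line they are entire of order at most
two, so they are exponentials of quadratics (`entire_eq_exp_quadratic`). The coefficients are
moments, hence polynomial in the direction, and the lines fit together. Riemann–Lebesgue makes the
quadratic form coercive, Fourier inversion applies, and the inverse transform of a Gaussian is a
Gaussian (`exists_ae_eq_exp_quadratic`). Dividing out the window shows that `f` and `g` are
generalized Gaussians.

Finally `c F/G = c F conj G / |G|²` is entire with positive real part on each line, hence constant.
All lines meet at the origin, so `F/G` is one constant, and Fourier uniqueness makes `g` a multiple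
of `f`. -/

/-! ### Entire functions: order at most two without zeros, and positive real part -/

open Filter Topology Metric in
/-- An entire function vanishing at the origin whose real part grows at most quadratically is a
quadratic polynomial. -/
theorem entire_eq_quadratic_of_re_le {L : ℂ → ℂ} (hd : Differentiable ℂ L) (h0 : L 0 = 0)
    {K : ℝ} (hK : ∀ t, (L t).re ≤ K * (1 + ‖t‖ ^ 2)) (t : ℂ) :
    L t = deriv L 0 * t + deriv (deriv L) 0 / 2 * t ^ 2 := by
  have hK0 : 0 ≤ K := by simpa [h0] using hK 0
  -- Borel–Carathéodory on the disc of radius `2R` bounds `‖L‖` on the circle of radius `R`, and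
  -- Cauchy's estimate does the rest. `K + 1` replaces `K` to keep the majorant strictly positive.
  have hbound (n : ℕ) {R : ℝ} (hR : 0 < R) :
      ‖iteratedDeriv n L 0‖ ≤ n.factorial * (2 * ((K + 1) * (1 + (2 * R) ^ 2))) / R ^ n := by
    refine Complex.norm_iteratedDeriv_le_of_forall_mem_sphere_norm_le n hR hd.diffContOnCl ?_
    intro z hz
    have hz' : ‖z‖ = R := by simpa using hz
    have := Complex.borelCaratheodory_zero (M := (K + 1) * (1 + (2 * R) ^ 2)) (R := 2 * R) (z := z)
      (by positivity) hd.differentiableOn (fun w hw => ?_) (by positivity)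
      (by simp [hz', hR]) h0
    · rw [hz'] at this
      refine this.trans (le_of_eq ?_)
      have : 2 * R - R = R := by ring
      rw [this]; field_simp
    · have hw' : ‖w‖ < 2 * R := by simpa using hw
      refine (hK w).trans ?_
      gcongr
      linarith
  have hvan (n : ℕ) : iteratedDeriv (n + 3) L 0 = 0 := by
    rw [← norm_le_zero_iff]
    have hl : Tendsto (fun R : ℝ => (n + 3).factorial * (2 * ((K + 1) * 5)) * R⁻¹)
        atTop (𝓝 0) := by
      simpa using tendsto_inv_atTop_zero.const_mul (((n + 3).factorial : ℝ) * (2 * ((K + 1) * 5)))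
    refine ge_of_tendsto hl ?_
    filter_upwards [eventually_ge_atTop 1] with R hR
    have hR0 : 0 < R := by linarith
    refine (hbound (n + 3) hR0).trans ?_
    rw [div_le_iff₀ (by positivity)]
    have h1 : R ^ 2 ≤ R ^ (n + 2) := pow_le_pow_right₀ hR (by lia)
    have h2 : 1 ≤ R ^ 2 := one_le_pow₀ hR
    have h3 : R⁻¹ * R ^ (n + 3) = R ^ (n + 2) := by rw [pow_succ]; field_simp
    rw [mul_assoc _ R⁻¹, h3, mul_assoc (_ : ℝ) _ (R ^ (n + 2))]
    have h4 : (K + 1) * (1 + (2 * R) ^ 2) ≤ (K + 1) * (5 * R ^ (n + 2)) := by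
      gcongr
      nlinarith
    refine mul_le_mul_of_nonneg_left ?_ (by positivity)
    linarith
  have := Complex.taylorSeries_eq_of_entire' (c := 0) (z := t) hd
  rw [← this, tsum_eq_sum (s := Finset.range 3)]
  · simp only [Finset.sum_range_succ, Finset.range_zero, Finset.sum_empty, iteratedDeriv_zero, h0,
      iteratedDeriv_succ, Nat.factorial, sub_zero]
    push_cast
    ring
  · intro n hn
    obtain ⟨m, rfl⟩ : ∃ m, n = m + 3 := ⟨n - 3, by simp at hn; lia⟩
    simp [hvan]

/-- A zero-free entire function of order at most two is the exponential of a quadratic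
polynomial, with coefficients determined by its derivatives at the origin. -/
theorem entire_eq_exp_quadratic {H H₁ H₂ : ℂ → ℂ} (hH : ∀ t, HasDerivAt H (H₁ t) t)
    (hH₁ : ∀ t, HasDerivAt H₁ (H₂ t) t) (h0 : ∀ t, H t ≠ 0) {C c : ℝ}
    (hC : ∀ t, ‖H t‖ ≤ C * Real.exp (c * ‖t‖ ^ 2)) (t : ℂ) :
    H t = H 0 * Complex.exp (H₁ 0 / H 0 * t +
      (H₂ 0 / H 0 - (H₁ 0 / H 0) ^ 2) / 2 * t ^ 2) := by
  have hq (s : ℂ) : HasDerivAt (fun t => H₁ t / H t)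
      ((H₂ s * H s - H₁ s * H₁ s) / H s ^ 2) s := (hH₁ s).div (hH s) (h0 s)
  have hqd : Differentiable ℂ fun t => H₁ t / H t := fun s => (hq s).differentiableAt
  -- `L` is the primitive of `H'/H` with `L 0 = 0`, a global logarithm of `H / H 0`.
  obtain ⟨L, hL0, hL⟩ := hqd.isExactOn_univ.with_val_at 0 0
  replace hL (s : ℂ) : HasDerivAt L (H₁ s / H s) s := hL s trivial
  have hLd : Differentiable ℂ L := fun s => (hL s).differentiableAt
  have hexp (s : ℂ) : H s = H 0 * Complex.exp (L s) := by
    have hder (s : ℂ) : HasDerivAt (fun t => H t * Complex.exp (-L t)) 0 s := by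
      convert! (hH s).mul (hL s).neg.cexp using 1
      field_simp [h0 s]
      ring
    have := is_const_of_deriv_eq_zero (fun s => (hder s).differentiableAt)
      (fun s => (hder s).deriv) s 0
    simp only [hL0, neg_zero, Complex.exp_zero, mul_one] at this
    rw [← this, mul_assoc, ← Complex.exp_add]
    simp
  have hCp : 0 < C := by
    have := hC 0
    have h1 : 0 < ‖H 0‖ := norm_pos_iff.2 (h0 0)
    simp at this
    linarith
  have hre (s : ℂ) : (L s).re ≤ (|Real.log (C / ‖H 0‖)| + |c|) * (1 + ‖s‖ ^ 2) := by
    have h1 : 0 < ‖H 0‖ := norm_pos_iff.2 (h0 0)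
    have h2 := hC s
    rw [hexp s, norm_mul, Complex.norm_exp] at h2
    have h3 : Real.exp (L s).re ≤ C / ‖H 0‖ * Real.exp (c * ‖s‖ ^ 2) := by
      rw [div_mul_eq_mul_div, le_div_iff₀ h1]; linarith
    rw [← Real.exp_log (show 0 < C / ‖H 0‖ by positivity), ← Real.exp_add, Real.exp_le_exp] at h3
    have h4 : Real.log (C / ‖H 0‖) ≤ |Real.log (C / ‖H 0‖)| := le_abs_self _
    have h5 : c * ‖s‖ ^ 2 ≤ |c| * ‖s‖ ^ 2 := by gcongr; exact le_abs_self _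
    nlinarith [abs_nonneg (Real.log (C / ‖H 0‖)), abs_nonneg c, sq_nonneg ‖s‖,
      mul_nonneg (abs_nonneg (Real.log (C / ‖H 0‖))) (sq_nonneg ‖s‖)]
  have hd1 : deriv L = fun t => H₁ t / H t := funext fun s => (hL s).deriv
  rw [hexp t, entire_eq_quadratic_of_re_le hLd hL0 hre t, hd1, (hq 0).deriv]
  congr 5
  field_simp [h0 0]

/-- Liouville's theorem for entire functions with positive real part. -/
theorem entire_apply_eq_of_re_pos {K : ℂ → ℂ} (hd : Differentiable ℂ K)
    (hK : ∀ t, 0 < (K t).re) (s t : ℂ) : K s = K t := by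
  have hne (t : ℂ) : 1 + K t ≠ 0 := by
    intro h
    have := congrArg Complex.re h
    simp at this
    linarith [hK t]
  -- Since `Re (1 + K) > 1`, this inverse is entire and bounded by `1`.
  have hd' : Differentiable ℂ fun t => (1 + K t)⁻¹ := fun t =>
    ((hd t).const_add 1).inv (hne t)
  have := hd'.apply_eq_apply_of_bounded ?_ s t
  · simpa using this
  · refine (isBounded_iff_forall_norm_le).2 ⟨1, ?_⟩
    rintro _ ⟨t, rfl⟩
    simp only [norm_inv]
    refine inv_le_one_of_one_le₀ (le_trans ?_ (Complex.re_le_norm _))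
    simp [(hK t).le]

/-! ### Functions integrable against all exponentials, and their Laplace transforms -/

section ExpIntegrable

variable {V : Type*} [NormedAddCommGroup V]

theorem norm_le_norm_mul_exp_norm [NormedSpace ℝ V] (l : V →L[ℝ] ℂ) (s : V) :
    ‖l s‖ ≤ ‖l‖ * Real.exp (1 * ‖s‖) := by
  refine (l.le_opNorm s).trans ?_
  gcongr
  linarith [Real.add_one_le_exp (1 * ‖s‖)]

theorem norm_cexp_le_exp_norm [NormedSpace ℝ V] (l : V →L[ℝ] ℂ) (t : ℂ) (s : V) :
    ‖Complex.exp (t * l s)‖ ≤ Real.exp (‖t‖ * ‖l‖ * ‖s‖) := by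
  rw [Complex.norm_exp, Real.exp_le_exp]
  refine (Complex.re_le_norm _).trans ?_
  rw [norm_mul, mul_assoc]
  gcongr
  exact l.le_opNorm s

variable [MeasurableSpace V] {μ : Measure V}

/-- A function whose product with `exp (R ‖s‖)` is integrable for every `R`. -/
def ExpIntegrable (k : V → ℂ) (μ : Measure V) : Prop :=
  ∀ R : ℝ, Integrable (fun s => (Real.exp (R * ‖s‖) : ℂ) * k s) μ

theorem ExpIntegrable.integrable {k : V → ℂ} (hk : ExpIntegrable k μ) : Integrable k μ := by
  simpa using hk 0

variable [BorelSpace V]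

/-- The growth `exp (S ‖s‖)` of the multiplier is absorbed by passing from `R` to `R + S`. -/
theorem ExpIntegrable.mul_of_norm_le {k m : V → ℂ} (hk : ExpIntegrable k μ) (hm : Continuous m)
    {C S : ℝ} (hC : ∀ s, ‖m s‖ ≤ C * Real.exp (S * ‖s‖)) : ExpIntegrable (fun s => k s * m s) μ := by
  intro R
  refine Integrable.mono' ((hk (R + S)).norm.const_mul C) ?_ (Filter.Eventually.of_forall fun s => ?_)
  · have : Continuous fun s : V => (Real.exp (R * ‖s‖) : ℂ) := by fun_prop
    exact this.aestronglyMeasurable.mul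
      (hk.integrable.aestronglyMeasurable.mul hm.aestronglyMeasurable)
  · simp only [norm_mul, Complex.norm_real, Real.norm_eq_abs, Real.abs_exp, add_mul, Real.exp_add]
    calc Real.exp (R * ‖s‖) * (‖k s‖ * ‖m s‖)
        ≤ Real.exp (R * ‖s‖) * (‖k s‖ * (C * Real.exp (S * ‖s‖))) := by gcongr; exact hC s
      _ = _ := by ring

variable [NormedSpace ℝ V]

theorem ExpIntegrable.mul_linear {k : V → ℂ} (hk : ExpIntegrable k μ) (l : V →L[ℝ] ℂ) :
    ExpIntegrable (fun s => k s * l s) μ :=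
  hk.mul_of_norm_le l.continuous (norm_le_norm_mul_exp_norm l)

theorem ExpIntegrable.mul_cexp {k : V → ℂ} (hk : ExpIntegrable k μ) (l : V →L[ℝ] ℂ) (t : ℂ) :
    ExpIntegrable (fun s => k s * Complex.exp (t * l s)) μ :=
  hk.mul_of_norm_le (C := 1) (by fun_prop) fun s => by
    simpa using norm_cexp_le_exp_norm l t s

/-- Differentiation under the integral, dominated on the unit ball around `t`. As `k * l` is again
exponentially integrable, the lemma can be iterated, and derivatives at `0` are moments of `k`. -/
theorem ExpIntegrable.hasDerivAt_integral {k : V → ℂ} (hk : ExpIntegrable k μ) (l : V →L[ℝ] ℂ)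
    (t : ℂ) : HasDerivAt (fun t : ℂ => ∫ s, k s * Complex.exp (t * l s) ∂μ)
      (∫ s, k s * l s * Complex.exp (t * l s) ∂μ) t := by
  refine (hasDerivAt_integral_of_dominated_loc_of_deriv_le
    (F := fun t s => k s * Complex.exp (t * l s))
    (F' := fun t s => k s * l s * Complex.exp (t * l s))
    (bound := fun s => ‖(Real.exp ((‖t‖ + 1) * ‖l‖ * ‖s‖) : ℂ) * (k s * l s)‖)
    (Metric.ball_mem_nhds t one_pos) ?_ ?_ ?_ ?_ ?_ ?_).2
  · exact Filter.Eventually.of_forall fun t => (hk.mul_cexp l t).integrable.aestronglyMeasurable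
  · exact (hk.mul_cexp l t).integrable
  · exact ((hk.mul_linear l).mul_cexp l t).integrable.aestronglyMeasurable
  · refine Filter.Eventually.of_forall fun s u hu => ?_
    have hu' : ‖u‖ ≤ ‖t‖ + 1 := by
      have := norm_sub_norm_le u t
      rw [Metric.mem_ball, dist_eq_norm] at hu
      linarith
    rw [norm_mul, norm_mul _ (k s * l s), mul_comm]
    refine mul_le_mul_of_nonneg_right ((norm_cexp_le_exp_norm l u s).trans ?_) (norm_nonneg _)
    simp only [Complex.norm_real, Real.norm_eq_abs, Real.abs_exp]
    gcongr
  · exact ((hk.mul_linear l) _).norm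
  · refine Filter.Eventually.of_forall fun s u _ => ?_
    have h := ((hasDerivAt_id u).mul_const (l s)).cexp.const_mul (k s)
    convert! h using 1
    simp only [id]
    ring

end ExpIntegrable

/-! ### Gaussian integrals with complex symmetric matrices -/

section GaussianIntegral

open Matrix

variable {d : ℕ}

/-- The vector of complexified coordinates. -/
def complexCoords (x : EuclideanSpace ℝ (Fin d)) : Fin d → ℂ := fun i => (x i : ℂ)

theorem complexCoords_add_smul (x y : EuclideanSpace ℝ (Fin d)) (r : ℝ) :
    complexCoords (x + r • y) = complexCoords x + (r : ℂ) • complexCoords y := by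
  ext i; simp [complexCoords]

theorem complexCoords_single (j : Fin d) :
    complexCoords (EuclideanSpace.single j (1 : ℝ)) = Pi.single j 1 := by
  ext i
  by_cases h : i = j
  · subst h; simp [complexCoords]
  · simp [complexCoords, h]

/-- The complex linear form `x ↦ ∑ wᵢ xᵢ`. -/
noncomputable def dotCLM (w : Fin d → ℂ) : EuclideanSpace ℝ (Fin d) →L[ℝ] ℂ :=
  LinearMap.toContinuousLinearMap
    { toFun := fun x => w ⬝ᵥ complexCoords x
      map_add' := fun x y => by
        have := complexCoords_add_smul x y 1
        simp only [one_smul, Complex.ofReal_one] at this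
        rw [this, dotProduct_add]
      map_smul' := fun r x => by
        have := complexCoords_add_smul 0 x r
        have h0 : complexCoords (0 : EuclideanSpace ℝ (Fin d)) = 0 := by ext i; simp [complexCoords]
        rw [zero_add, h0, zero_add] at this
        simp [this] }

theorem dotCLM_apply (w : Fin d → ℂ) (x : EuclideanSpace ℝ (Fin d)) :
    dotCLM w x = w ⬝ᵥ complexCoords x := rfl

/-- The quadratic form of a complex matrix on real vectors. -/
noncomputable def quadForm (A : Matrix (Fin d) (Fin d) ℂ) (x : EuclideanSpace ℝ (Fin d)) : ℂ :=
  complexCoords x ⬝ᵥ A *ᵥ complexCoords x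

@[fun_prop]
theorem continuous_quadForm (A : Matrix (Fin d) (Fin d) ℂ) : Continuous (quadForm A) := by
  unfold quadForm dotProduct mulVec complexCoords dotProduct
  fun_prop

theorem quadForm_add_smul {A : Matrix (Fin d) (Fin d) ℂ} (hA : A.IsSymm)
    (x y : EuclideanSpace ℝ (Fin d)) (r : ℝ) :
    quadForm A (x + r • y) =
      quadForm A x + 2 * r * (complexCoords y ⬝ᵥ A *ᵥ complexCoords x) + r ^ 2 * quadForm A y := by
  have : complexCoords x ⬝ᵥ A *ᵥ complexCoords y = complexCoords y ⬝ᵥ A *ᵥ complexCoords x := by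
    rw [dotProduct_mulVec, ← mulVec_transpose, hA.eq, dotProduct_comm]
  simp only [quadForm, complexCoords_add_smul, mulVec_add, mulVec_smul, dotProduct_add,
    add_dotProduct, dotProduct_smul, smul_dotProduct, this, smul_eq_mul]
  ring

/-- Half of the Gaussian decay is kept for integrability; completing the square, the other half
absorbs `exp (R ‖x‖)`. -/
theorem expIntegrable_gaussian {c : ℝ} (hc : 0 < c) {k : EuclideanSpace ℝ (Fin d) → ℂ}
    (hk : Continuous k) (h : ∀ x, ‖k x‖ ≤ Real.exp (-c * ‖x‖ ^ 2)) :
    ExpIntegrable k volume := by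
  intro R
  have hi : Integrable (fun x : EuclideanSpace ℝ (Fin d) =>
      Real.exp (-(c / 2) * ‖x‖ ^ 2)) volume := by
    have := (GaussianFourier.integrable_cexp_neg_mul_sq_norm_add (V := EuclideanSpace ℝ (Fin d))
      (b := ((c / 2 : ℝ) : ℂ)) (by simpa using hc) 0 0).norm
    refine this.congr (Filter.Eventually.of_forall fun x => ?_)
    simp [Complex.norm_exp, ← Complex.ofReal_pow]
  refine (hi.const_mul (Real.exp (R ^ 2 / (2 * c)))).mono' (by fun_prop)
    (Filter.Eventually.of_forall fun x => ?_)
  rw [norm_mul, Complex.norm_real, Real.norm_eq_abs, Real.abs_exp, ← Real.exp_add]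
  calc _ ≤ Real.exp (R * ‖x‖) * Real.exp (-c * ‖x‖ ^ 2) := by gcongr; exact h x
    _ ≤ _ := by
      rw [← Real.exp_add, Real.exp_le_exp]
      have : R ^ 2 / (2 * c) + -(c / 2) * ‖x‖ ^ 2 - (R * ‖x‖ + -c * ‖x‖ ^ 2)
        = (R - c * ‖x‖) ^ 2 / (2 * c) := by field_simp; ring
      have h2 : 0 ≤ (R - c * ‖x‖) ^ 2 / (2 * c) := by positivity
      linarith

variable {A : Matrix (Fin d) (Fin d) ℂ} {c : ℝ}

theorem expIntegrable_cexp_neg_quadForm (hc : 0 < c) (hA : ∀ x, c * ‖x‖ ^ 2 ≤ (quadForm A x).re) :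
    ExpIntegrable (fun x => Complex.exp (-quadForm A x)) volume := by
  refine expIntegrable_gaussian hc (by fun_prop) fun x => ?_
  rw [Complex.norm_exp, Real.exp_le_exp]
  simpa using hA x

/-- If `A v = 0` with `v = x + iy`, pairing with the conjugate `x - iy` cancels the cross terms by
symmetry and leaves `quadForm A x + quadForm A y = 0`; coercivity then forces `x = y = 0`. -/
theorem isUnit_of_quadForm_coercive (hs : A.IsSymm) (hc : 0 < c)
    (hA : ∀ x, c * ‖x‖ ^ 2 ≤ (quadForm A x).re) : IsUnit A := by
  rw [← mulVec_injective_iff_isUnit, ← coe_mulVecLin, ← LinearMap.ker_eq_bot,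
    LinearMap.ker_eq_bot']
  intro v hv
  rw [mulVecLin_apply] at hv
  let x : EuclideanSpace ℝ (Fin d) := WithLp.toLp 2 fun i => (v i).re
  let y : EuclideanSpace ℝ (Fin d) := WithLp.toLp 2 fun i => (v i).im
  have hvxy : v = complexCoords x + Complex.I • complexCoords y := by
    ext i
    simp only [complexCoords, x, y, Pi.add_apply, Pi.smul_apply, smul_eq_mul]
    rw [mul_comm, Complex.re_add_im]
  have hsym : complexCoords x ⬝ᵥ A *ᵥ complexCoords y
      = complexCoords y ⬝ᵥ A *ᵥ complexCoords x := by
    rw [dotProduct_mulVec, ← mulVec_transpose, hs.eq, dotProduct_comm]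
  have h0 : quadForm A x + quadForm A y = 0 := by
    have : (complexCoords x - Complex.I • complexCoords y) ⬝ᵥ A *ᵥ v = 0 := by simp [hv]
    rw [hvxy] at this
    simp only [mulVec_add, mulVec_smul, dotProduct_add, sub_dotProduct, dotProduct_smul,
      smul_dotProduct, hsym, smul_eq_mul] at this
    simp only [quadForm]
    linear_combination this + (complexCoords y ⬝ᵥ A *ᵥ complexCoords y) * Complex.I_mul_I
  have h0' := congrArg Complex.re h0
  simp only [Complex.add_re, Complex.zero_re] at h0'
  have hx := hA x
  have hy := hA y
  have hx0 : ‖x‖ ^ 2 = 0 := by nlinarith [sq_nonneg ‖x‖, sq_nonneg ‖y‖]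
  have hy0 : ‖y‖ ^ 2 = 0 := by nlinarith [sq_nonneg ‖x‖, sq_nonneg ‖y‖]
  have hx1 : x = 0 := by simpa using hx0
  have hy1 : y = 0 := by simpa using hy0
  rw [hvxy, hx1, hy1]
  ext i; simp [complexCoords]

theorem hasLineDerivAt_gaussian (hs : A.IsSymm) (w : Fin d → ℂ) (t : ℂ)
    (x v : EuclideanSpace ℝ (Fin d)) :
    HasLineDerivAt ℝ (fun x => Complex.exp (-quadForm A x) * Complex.exp (t * dotCLM w x))
      ((-2 * (complexCoords v ⬝ᵥ A *ᵥ complexCoords x) + t * dotCLM w v) *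
        (Complex.exp (-quadForm A x) * Complex.exp (t * dotCLM w x))) x v := by
  unfold HasLineDerivAt
  simp only [quadForm_add_smul hs, map_add, map_smul, ← Complex.exp_add]
  have hr : HasDerivAt (fun r : ℝ => (r : ℂ)) 1 0 := Complex.ofRealCLM.hasDerivAt
  have h1 : HasDerivAt (fun r : ℝ => -(quadForm A x + 2 * r * (complexCoords v ⬝ᵥ A *ᵥ
      complexCoords x) + r ^ 2 * quadForm A v) + t * (dotCLM w x + r • dotCLM w v))
      (-2 * (complexCoords v ⬝ᵥ A *ᵥ complexCoords x) + t * dotCLM w v) 0 := by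
    have h2 := ((((hr.const_mul 2).mul_const (complexCoords v ⬝ᵥ A *ᵥ complexCoords x)).const_add
      (quadForm A x)).add ((hr.pow 2).mul_const (quadForm A v))).neg.add
      (((hr.mul_const (dotCLM w v)).const_add (dotCLM w x)).const_mul t)
    convert! h2 using 1
    simp
  convert! h1.cexp using 1
  simp
  ring

theorem integrable_gaussian_deriv (hc : 0 < c)
    (hA : ∀ x, c * ‖x‖ ^ 2 ≤ (quadForm A x).re) (w : Fin d → ℂ) (t : ℂ)
    (v : EuclideanSpace ℝ (Fin d)) :
    Integrable fun x => 2 * (complexCoords v ⬝ᵥ A *ᵥ complexCoords x) *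
      (Complex.exp (-quadForm A x) * Complex.exp (t * dotCLM w x)) := by
  have hG := (expIntegrable_cexp_neg_quadForm hc hA).mul_cexp (dotCLM w) t
  refine (((hG.mul_linear (dotCLM (complexCoords v ᵥ* A))).integrable).const_mul 2).congr
    (Filter.Eventually.of_forall fun x => ?_)
  simp only [dotCLM_apply, dotProduct_mulVec]
  ring

/-- The integral of a directional derivative vanishes: integration by parts against the constant
`1`. -/
theorem integral_gaussian_deriv (hs : A.IsSymm) (hc : 0 < c)
    (hA : ∀ x, c * ‖x‖ ^ 2 ≤ (quadForm A x).re) (w : Fin d → ℂ) (t : ℂ)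
    (v : EuclideanSpace ℝ (Fin d)) :
    ∫ x, 2 * (complexCoords v ⬝ᵥ A *ᵥ complexCoords x) *
      (Complex.exp (-quadForm A x) * Complex.exp (t * dotCLM w x)) =
    t * dotCLM w v * ∫ x, Complex.exp (-quadForm A x) * Complex.exp (t * dotCLM w x) := by
  set G := fun x => Complex.exp (-quadForm A x) * Complex.exp (t * dotCLM w x) with hG
  have hGi : ExpIntegrable G volume := (expIntegrable_cexp_neg_quadForm hc hA).mul_cexp _ _
  have hi1 : Integrable fun x => 2 * (complexCoords v ⬝ᵥ A *ᵥ complexCoords x) * G x :=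
    integrable_gaussian_deriv hc hA w t v
  have hi2 : Integrable fun x => t * dotCLM w v * G x := hGi.integrable.const_mul _
  have key := integral_bilinear_hasLineDerivAt_right_eq_neg_left_of_integrable
    (μ := (volume : Measure (EuclideanSpace ℝ (Fin d)))) (f := fun _ => (1 : ℂ)) (f' := fun _ => 0)
    (g := G) (v := v) (B := ContinuousLinearMap.mul ℝ ℂ)
    (g' := fun x => (-2 * (complexCoords v ⬝ᵥ A *ᵥ complexCoords x) + t * dotCLM w v) * G x)
    (by simp) ?_ (by simpa using hGi.integrable)
    (fun x _ => by simpa [HasLineDerivAt] using hasDerivAt_const (0 : ℝ) (1 : ℂ))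
    (fun x _ => hasLineDerivAt_gaussian hs w t x v)
  · have h3 : ∀ x, (-2 * (complexCoords v ⬝ᵥ A *ᵥ complexCoords x) + t * dotCLM w v) * G x =
        t * dotCLM w v * G x - 2 * (complexCoords v ⬝ᵥ A *ᵥ complexCoords x) * G x := fun x => by
      ring
    simp only [ContinuousLinearMap.mul_apply', one_mul, zero_mul, integral_zero, neg_zero, h3] at key
    rw [integral_sub hi2 hi1, sub_eq_zero] at key
    rw [← key, integral_const_mul]
  · refine (hi2.sub hi1).congr (Filter.Eventually.of_forall fun x => ?_)
    simp only [Pi.sub_apply, ContinuousLinearMap.mul_apply', one_mul]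
    ring

/-- The Laplace transform of a Gaussian with complex covariance, up to the value at the origin. -/
theorem integral_gaussian_mul_cexp (hs : A.IsSymm) (hc : 0 < c)
    (hA : ∀ x, c * ‖x‖ ^ 2 ≤ (quadForm A x).re) (w : Fin d → ℂ) :
    ∫ x, Complex.exp (-quadForm A x) * Complex.exp (dotCLM w x) =
      (∫ x, Complex.exp (-quadForm A x)) * Complex.exp (w ⬝ᵥ A⁻¹ *ᵥ w / 4) := by
  have hU := isUnit_of_quadForm_coercive hs hc hA
  have hdet : IsUnit A.det := (Matrix.isUnit_iff_isUnit_det A).1 hU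
  set k := fun x => Complex.exp (-quadForm A x) with hk
  have hki : ExpIntegrable k volume := expIntegrable_cexp_neg_quadForm hc hA
  set κ : ℂ := w ⬝ᵥ A⁻¹ *ᵥ w / 4 with hκ
  set J := fun t : ℂ => ∫ x, k x * Complex.exp (t * dotCLM w x) with hJ
  -- This differential equation makes `J t * exp (-t²κ)` constant; comparing `t = 1` with `t = 0`
  -- gives the formula. It follows from `w ⬝ x = (A⁻¹ w) ⬝ (A x)`, which turns the first moment into
  -- a combination of the integrals evaluated by parts.
  have hder (t : ℂ) : HasDerivAt J (2 * t * κ * J t) t := by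
    convert! hki.hasDerivAt_integral (dotCLM w) t using 1
    have hexp (x : EuclideanSpace ℝ (Fin d)) : k x * dotCLM w x * Complex.exp (t * dotCLM w x) =
        ∑ j, (A⁻¹ *ᵥ w) j / 2 * (2 * (complexCoords (EuclideanSpace.single j (1 : ℝ)) ⬝ᵥ
          A *ᵥ complexCoords x) * (k x * Complex.exp (t * dotCLM w x))) := by
      have hsing (j : Fin d) : complexCoords (EuclideanSpace.single j (1 : ℝ)) ⬝ᵥ
          A *ᵥ complexCoords x = (A *ᵥ complexCoords x) j := by
        rw [complexCoords_single, single_one_dotProduct]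
      have h1 : dotCLM w x = (A⁻¹ *ᵥ w) ⬝ᵥ A *ᵥ complexCoords x := by
        rw [dotCLM_apply, dotProduct_mulVec, ← mulVec_transpose, hs.eq, mulVec_mulVec,
          Matrix.mul_nonsing_inv _ hdet, one_mulVec]
      simp only [hsing]
      rw [h1]
      simp only [dotProduct, Finset.mul_sum, Finset.sum_mul]
      refine Finset.sum_congr rfl fun j _ => ?_
      ring
    simp_rw [hexp]
    rw [integral_finsetSum]
    · have h2 (j : Fin d) : dotCLM w (EuclideanSpace.single j (1 : ℝ)) = w j := by
        rw [dotCLM_apply, complexCoords_single, dotProduct_single_one]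
      simp_rw [integral_const_mul, hk, integral_gaussian_deriv hs hc hA w t, h2]
      rw [hκ, dotProduct, hJ, hk, Finset.sum_div, Finset.mul_sum, Finset.sum_mul]
      refine Finset.sum_congr rfl fun j _ => ?_
      ring
    · exact fun j _ => (integrable_gaussian_deriv hc hA w t _).const_mul _
  have hder' (t : ℂ) : HasDerivAt (fun t => J t * Complex.exp (-(t ^ 2 * κ))) 0 t := by
    convert! (hder t).mul (((hasDerivAt_id t).pow 2).mul_const κ).neg.cexp using 1
    simp
    ring
  have := is_const_of_deriv_eq_zero (fun s => (hder' s).differentiableAt)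
    (fun s => (hder' s).deriv) 1 0
  simp only [hJ, one_mul, one_pow, zero_mul, ne_eq, OfNat.ofNat_ne_zero, not_false_eq_true,
    zero_pow, neg_zero, Complex.exp_zero, mul_one] at this
  rw [← this, mul_assoc, ← Complex.exp_add]
  simp [hk]

end GaussianIntegral

/-! ### Fourier inversion almost everywhere -/

section FourierInversion

open FourierTransform
open scoped ContDiff

variable {V : Type*} [NormedAddCommGroup V] [InnerProductSpace ℝ V] [FiniteDimensional ℝ V]
  [MeasurableSpace V] [BorelSpace V]

theorem integral_fourier_mul_of_integrable {f g : V → ℂ} (hf : Integrable f) (hg : Integrable g) :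
    ∫ ξ, 𝓕 f ξ * g ξ = ∫ x, f x * 𝓕 g x := by
  have h := VectorFourier.integral_fourierIntegral_smul_eq_flip (L := innerₗ V)
    Real.continuous_fourierChar continuous_inner hf hg
  simp only [smul_eq_mul, flip_innerₗ] at h
  exact h

theorem integral_fourierInv_mul_of_integrable {f g : V → ℂ} (hf : Integrable f)
    (hg : Integrable g) : ∫ ξ, 𝓕⁻ f ξ * g ξ = ∫ x, f x * 𝓕⁻ g x := by
  have h := integral_fourier_mul_of_integrable (hf.comp_neg) hg
  rw [← integral_neg_eq_self (fun x => f x * 𝓕⁻ g x)]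
  rw [← Real.fourierInv_eq_fourier_comp_neg] at h
  simpa [Real.fourierInv_eq_fourier_neg g] using h

theorem continuous_fourier_of_integrable {f : V → ℂ} (hf : Integrable f) : Continuous (𝓕 f) :=
  VectorFourier.fourierIntegral_continuous Real.continuous_fourierChar
    (L := innerₗ V) continuous_inner hf

/-- Fourier inversion almost everywhere, for integrable functions with integrable transform. -/
theorem ae_eq_fourierInv_fourier {f : V → ℂ} (hf : Integrable f) (hf' : Integrable (𝓕 f)) :
    f =ᵐ[volume] 𝓕⁻ (𝓕 f) := by
  have hc : Continuous (𝓕⁻ (𝓕 f)) := by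
    rw [Real.fourierInv_eq_fourier_comp_neg]
    exact continuous_fourier_of_integrable hf'.comp_neg
  -- Against a test function, moving both transforms across the integral reduces the claim to
  -- inversion for Schwartz functions.
  refine ae_eq_of_integral_contDiff_smul_eq hf.locallyIntegrable hc.locallyIntegrable
    fun φ hφ hφc => ?_
  have hφ' : ContDiff ℝ ∞ fun x => (φ x : ℂ) := Complex.ofRealCLM.contDiff.comp hφ
  have hφc' : HasCompactSupport fun x => (φ x : ℂ) := hφc.comp_left (g := Complex.ofReal) rfl
  set Φ : SchwartzMap V ℂ := hφc'.toSchwartzMap hφ' with hΦ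
  have hΦφ (x : V) : Φ x = (φ x : ℂ) := rfl
  have h1 := integral_fourierInv_mul_of_integrable Φ.integrable hf'
  have h2 := integral_fourier_mul_of_integrable (𝓕⁻ Φ).integrable hf
  have h3 : 𝓕 ((𝓕⁻ Φ : SchwartzMap V ℂ) : V → ℂ) = Φ := by
    rw [← SchwartzMap.fourier_coe, FourierTransform.fourier_fourierInv_eq]
  rw [h3] at h2
  rw [SchwartzMap.fourierInv_coe] at h2
  simp only [Complex.real_smul, ← hΦφ]
  rw [h2, h1]

end FourierInversion

/-! ### From zero-free transforms to exponentials of quadratics -/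

section FourierGaussian

open Matrix FourierTransform

variable {d : ℕ}

/-- The linear form `s ↦ -2πi⟨y, s⟩`, the exponent of the Fourier transform. -/
noncomputable def fourierForm (y : EuclideanSpace ℝ (Fin d)) : EuclideanSpace ℝ (Fin d) →L[ℝ] ℂ :=
  dotCLM ((-(2 * Real.pi * Complex.I)) • complexCoords y)

theorem dotProduct_complexCoords (x y : EuclideanSpace ℝ (Fin d)) :
    complexCoords x ⬝ᵥ complexCoords y = ((inner ℝ x y : ℝ) : ℂ) := by
  simp [dotProduct, complexCoords, PiLp.inner_apply, mul_comm]

theorem fourierForm_apply (y s : EuclideanSpace ℝ (Fin d)) :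
    fourierForm y s = -(2 * Real.pi * Complex.I) * ((inner ℝ y s : ℝ) : ℂ) := by
  rw [fourierForm, dotCLM_apply, smul_dotProduct, dotProduct_complexCoords, smul_eq_mul]

theorem fourierForm_eq_sum (y s : EuclideanSpace ℝ (Fin d)) :
    fourierForm y s = ∑ i, (y i : ℂ) * fourierForm (EuclideanSpace.single i 1) s := by
  simp only [fourierForm, dotCLM_apply, smul_dotProduct, complexCoords_single,
    single_one_dotProduct, smul_eq_mul]
  rw [dotProduct, Finset.mul_sum]
  refine Finset.sum_congr rfl fun i _ => ?_
  simp only [complexCoords]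
  ring

theorem fourier_eq_integral_fourierForm (h : EuclideanSpace ℝ (Fin d) → ℂ)
    (y : EuclideanSpace ℝ (Fin d)) : 𝓕 h y = ∫ s, h s * Complex.exp (fourierForm y s) := by
  rw [Real.fourier_eq']
  refine integral_congr_ae (Filter.Eventually.of_forall fun s => ?_)
  simp only [smul_eq_mul, fourierForm_apply, real_inner_comm y s]
  rw [mul_comm]
  congr 2
  push_cast
  ring

theorem dotCLM_add (v w : Fin d → ℂ) (x : EuclideanSpace ℝ (Fin d)) :
    dotCLM (v + w) x = dotCLM v x + dotCLM w x := by
  simp [dotCLM_apply, add_dotProduct]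

/-- If the Fourier–Laplace transform of `h` has no zeros on complexified real lines and has order
at most two there, then the Fourier transform of `h` is the exponential of a quadratic. -/
theorem fourier_eq_exp_quadratic {h : EuclideanSpace ℝ (Fin d) → ℂ} (hh : ExpIntegrable h volume)
    (hne : ∀ y (t : ℂ), ∫ s, h s * Complex.exp (t * fourierForm y s) ≠ 0)
    (hC : ∀ y, ∃ C c : ℝ, ∀ t : ℂ,
      ‖∫ s, h s * Complex.exp (t * fourierForm y s)‖ ≤ C * Real.exp (c * ‖t‖ ^ 2)) :
    ∃ (A : Matrix (Fin d) (Fin d) ℂ) (b : Fin d → ℂ), A.IsSymm ∧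
      ∀ y, 𝓕 h y = (∫ s, h s) * (Complex.exp (-quadForm A y) * Complex.exp (dotCLM b y)) := by
  set e := fun i : Fin d => fourierForm (d := d) (EuclideanSpace.single i 1) with he
  set M := ∫ s, h s with hM
  set β : Fin d → ℂ := fun i => ∫ s, h s * e i s with hβ
  set N : Matrix (Fin d) (Fin d) ℂ := .of fun i j => ∫ s, h s * e i s * e j s with hN
  have hM0 : M ≠ 0 := by simpa using hne 0 0
  have hm1 (y : EuclideanSpace ℝ (Fin d)) : ∫ s, h s * fourierForm y s = dotCLM β y := by
    simp_rw [fourierForm_eq_sum y, Finset.mul_sum]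
    rw [integral_finsetSum]
    · rw [dotCLM_apply, dotProduct]
      refine Finset.sum_congr rfl fun i _ => ?_
      rw [hβ, ← integral_mul_const]
      congr with s
      simp only [complexCoords, he]
      ring
    · intro i _
      refine ((hh.mul_linear (e i)).integrable.const_mul (y i : ℂ)).congr
        (Filter.Eventually.of_forall fun s => ?_)
      simp only [he]
      ring
  have hm2 (y : EuclideanSpace ℝ (Fin d)) :
      ∫ s, h s * fourierForm y s * fourierForm y s = quadForm N y := by
    have hexp (s : EuclideanSpace ℝ (Fin d)) : h s * fourierForm y s * fourierForm y s =
        ∑ i, ∑ j, (y i : ℂ) * y j * (h s * e i s * e j s) := by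
      rw [fourierForm_eq_sum y, mul_assoc, Finset.sum_mul_sum, Finset.mul_sum]
      simp_rw [Finset.mul_sum]
      refine Finset.sum_congr rfl fun i _ => Finset.sum_congr rfl fun j _ => ?_
      simp only [he]
      ring
    have hi (i j : Fin d) : Integrable fun s => (y i : ℂ) * y j * (h s * e i s * e j s) :=
      ((hh.mul_linear (e i)).mul_linear (e j)).integrable.const_mul _
    simp_rw [hexp]
    rw [integral_finsetSum _ fun i _ => integrable_finsetSum _ fun j _ => hi i j]
    simp_rw [integral_finsetSum _ fun j _ => hi _ j, integral_const_mul]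
    simp only [quadForm, dotProduct, mulVec, Finset.mul_sum, hN, of_apply, complexCoords]
    refine Finset.sum_congr rfl fun i _ => Finset.sum_congr rfl fun j _ => ?_
    ring
  -- Mean and covariance of `h / M` in the coordinates `e i`: the second-order Taylor data of the
  -- logarithm of the transform. The minus sign offsets the one in `exp (-quadForm A y)`.
  refine ⟨-(1 / 2 : ℂ) • (M⁻¹ • N - vecMulVec (M⁻¹ • β) (M⁻¹ • β)), M⁻¹ • β, ?_, fun y => ?_⟩
  · have hNs : N.IsSymm := by
      ext i j
      simp only [hN, transpose_apply, of_apply]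
      congr with s
      ring
    ext i j
    have := hNs.apply i j
    simp only [transpose_apply, Matrix.smul_apply, Matrix.sub_apply, vecMulVec_apply, this]
    ring
  · obtain ⟨C, c, hCc⟩ := hC y
    -- On the line through `y`, evaluated at `t = 1`; the coefficients are the moments `hm1` and
    -- `hm2`, which depend on `y` linearly and quadratically.
    have key := entire_eq_exp_quadratic (fun t => hh.hasDerivAt_integral (fourierForm y) t)
      (fun t => (hh.mul_linear (fourierForm y)).hasDerivAt_integral (fourierForm y) t)
      (hne y) hCc 1
    simp only [one_mul, zero_mul, Complex.exp_zero, mul_one, one_pow, hm1, hm2] at key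
    rw [fourier_eq_integral_fourierForm, key, ← hM, ← Complex.exp_add]
    congr 2
    have h1 : dotCLM (M⁻¹ • β) y = dotCLM β y / M := by
      simp [dotCLM_apply, div_eq_inv_mul]
    have h2 : quadForm (-(1 / 2 : ℂ) • (M⁻¹ • N - vecMulVec (M⁻¹ • β) (M⁻¹ • β))) y =
        -(1 / 2) * (quadForm N y / M - (dotCLM β y / M) ^ 2) := by
      rw [← h1]
      simp only [quadForm, smul_mulVec, sub_mulVec, dotProduct_smul, dotProduct_sub,
        vecMulVec_mulVec, dotCLM_apply, smul_eq_mul]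
      simp [div_eq_inv_mul, dotProduct_comm (complexCoords y)]
      ring
    rw [h1, h2]
    ring

theorem quadForm_smul (A : Matrix (Fin d) (Fin d) ℂ) (r : ℝ) (y : EuclideanSpace ℝ (Fin d)) :
    quadForm A (r • y) = r ^ 2 * quadForm A y := by
  have : complexCoords (r • y) = (r : ℂ) • complexCoords y := by ext i; simp [complexCoords]
  simp only [quadForm, this, mulVec_smul, dotProduct_smul, smul_dotProduct, smul_eq_mul]
  ring

/-- The minimum over the compact unit sphere serves as the constant, by homogeneity. -/
theorem quadForm_coercive_of_pos {A : Matrix (Fin d) (Fin d) ℂ}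
    (hA : ∀ y, y ≠ 0 → 0 < (quadForm A y).re) :
    ∃ c > 0, ∀ x, c * ‖x‖ ^ 2 ≤ (quadForm A x).re := by
  by_cases hne : (Metric.sphere (0 : EuclideanSpace ℝ (Fin d)) 1).Nonempty
  · obtain ⟨u, hu, hmin⟩ := (isCompact_sphere (0 : EuclideanSpace ℝ (Fin d)) 1).exists_isMinOn hne
      (f := fun x => (quadForm A x).re) (by fun_prop)
    have hu1 : ‖u‖ = 1 := by simpa using hu
    refine ⟨(quadForm A u).re, hA u (by rintro rfl; simp at hu1), fun x => ?_⟩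
    by_cases hx : x = 0
    · subst hx
      have := quadForm_smul A 0 (0 : EuclideanSpace ℝ (Fin d))
      simp at this
      simp [this]
    · have hxn : 0 < ‖x‖ := norm_pos_iff.2 hx
      have h1 : ‖x‖ • (‖x‖⁻¹ • x) = x := by rw [smul_smul, mul_inv_cancel₀ hxn.ne', one_smul]
      have h2 : (quadForm A u).re ≤ (quadForm A (‖x‖⁻¹ • x)).re := hmin (by
        simp [norm_smul, hxn.ne'])
      have h3 := quadForm_smul A ‖x‖ (‖x‖⁻¹ • x)
      rw [h1] at h3
      rw [h3, ← Complex.ofReal_pow, Complex.re_ofReal_mul]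
      nlinarith [sq_nonneg ‖x‖]
  -- An empty sphere means that the space is zero (`d = 0`).
  · refine ⟨1, one_pos, fun x => ?_⟩
    have hx : x = 0 := by
      by_contra hx
      exact hne ⟨‖x‖⁻¹ • x, by simp [norm_smul, hx]⟩
    subst hx
    have := quadForm_smul A 0 (0 : EuclideanSpace ℝ (Fin d))
    simp at this
    simp [this]

open Filter Topology in
/-- By the Riemann–Lebesgue lemma, a Gaussian that is the Fourier transform of a function decays. -/
theorem quadForm_re_pos_of_fourier_eq {h : EuclideanSpace ℝ (Fin d) → ℂ} {M : ℂ} (hM : M ≠ 0)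
    {A : Matrix (Fin d) (Fin d) ℂ} {b : Fin d → ℂ}
    (hF : ∀ y, 𝓕 h y = M * (Complex.exp (-quadForm A y) * Complex.exp (dotCLM b y)))
    {y : EuclideanSpace ℝ (Fin d)} (hy : y ≠ 0) : 0 < (quadForm A y).re := by
  by_contra! hneg
  -- Passing to `-y` fixes the quadratic form and flips the linear one. With both signs favourable,
  -- the transform has norm at least `‖M‖` along the ray through `y`, contradicting
  -- Riemann–Lebesgue.
  wlog hb : 0 ≤ (dotCLM b y).re generalizing y
  · refine this (y := -y) (by simpa using hy) ?_ ?_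
    · have := quadForm_smul A (-1) y
      simp at this
      rwa [this]
    · simp; linarith
  have hlim : Tendsto (fun r : ℝ => 𝓕 h (r • y)) atTop (𝓝 0) := by
    have hRL : Tendsto (𝓕 h) (cocompact (EuclideanSpace ℝ (Fin d))) (𝓝 0) :=
      (tendsto_integral_exp_inner_smul_cocompact h).congr fun w => (Real.fourier_eq h w).symm
    refine hRL.comp ?_
    rw [← Metric.cobounded_eq_cocompact, ← tendsto_norm_atTop_iff_cobounded]
    simp only [norm_smul]
    exact tendsto_abs_atTop_atTop.atTop_mul_const (norm_pos_iff.2 hy)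
  have hlim' := hlim.norm
  rw [norm_zero] at hlim'
  have hMpos : 0 < ‖M‖ := norm_pos_iff.2 hM
  obtain ⟨r, hr, hr0⟩ := ((hlim'.eventually (gt_mem_nhds hMpos)).and (eventually_ge_atTop 0)).exists
  rw [hF, ← Complex.exp_add, norm_mul, Complex.norm_exp, quadForm_smul, map_smul] at hr
  have h1 : 0 ≤ (-((r : ℂ) ^ 2 * quadForm A y) + r • dotCLM b y).re := by
    rw [← Complex.ofReal_pow, Complex.add_re, Complex.neg_re, Complex.re_ofReal_mul,
      Complex.smul_re, smul_eq_mul]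
    nlinarith [mul_nonneg hr0 hb, sq_nonneg r]
  have h2 := Real.one_le_exp h1
  nlinarith

/-- The polynomial `∑ᵢⱼ Aᵢⱼ (bᵢ + z xᵢ) (bⱼ + z xⱼ)`. -/
noncomputable def shiftedQuadPoly (A : Matrix (Fin d) (Fin d) ℂ) (b : Fin d → ℂ) (z : ℂ) :
    MvPolynomial (Fin d) ℂ :=
  ∑ i, ∑ j, MvPolynomial.C (A i j) * ((MvPolynomial.C (b i) + MvPolynomial.C z * MvPolynomial.X i) *
    (MvPolynomial.C (b j) + MvPolynomial.C z * MvPolynomial.X j))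

theorem totalDegree_shiftedQuadPoly_le (A : Matrix (Fin d) (Fin d) ℂ) (b : Fin d → ℂ) (z : ℂ) :
    (shiftedQuadPoly A b z).totalDegree ≤ 2 := by
  have h1 (i : Fin d) :
      (MvPolynomial.C (b i) + MvPolynomial.C z * MvPolynomial.X i).totalDegree ≤ 1 := by
    refine (MvPolynomial.totalDegree_add _ _).trans (max_le (by simp) ?_)
    refine (MvPolynomial.totalDegree_mul _ _).trans ?_
    simp
  refine MvPolynomial.totalDegree_finsetSum_le fun i _ =>
    MvPolynomial.totalDegree_finsetSum_le fun j _ => ?_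
  refine (MvPolynomial.totalDegree_mul _ _).trans ?_
  have := MvPolynomial.totalDegree_mul (MvPolynomial.C (b i) + MvPolynomial.C z * MvPolynomial.X i)
    (MvPolynomial.C (b j) + MvPolynomial.C z * MvPolynomial.X j)
  rw [MvPolynomial.totalDegree_C]
  linarith [h1 i, h1 j]

theorem eval_shiftedQuadPoly (A : Matrix (Fin d) (Fin d) ℂ) (b : Fin d → ℂ) (z : ℂ)
    (x : EuclideanSpace ℝ (Fin d)) :
    MvPolynomial.eval (fun i => (x i : ℂ)) (shiftedQuadPoly A b z) =
      (b + z • complexCoords x) ⬝ᵥ A *ᵥ (b + z • complexCoords x) := by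
  simp only [shiftedQuadPoly, map_sum, map_mul, map_add, MvPolynomial.eval_C, MvPolynomial.eval_X,
    dotProduct, mulVec, Finset.mul_sum, Pi.add_apply, Pi.smul_apply, smul_eq_mul, complexCoords]
  refine Finset.sum_congr rfl fun i _ => Finset.sum_congr rfl fun j _ => ?_
  ring

/-- A function whose Fourier–Laplace transform has no zeros on complexified real lines and order at
most two there is the exponential of a polynomial of degree at most two. -/
theorem exists_ae_eq_exp_quadratic {h : EuclideanSpace ℝ (Fin d) → ℂ}
    (hh : ExpIntegrable h volume)
    (hne : ∀ y (t : ℂ), ∫ s, h s * Complex.exp (t * fourierForm y s) ≠ 0)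
    (hC : ∀ y, ∃ C c : ℝ, ∀ t : ℂ,
      ‖∫ s, h s * Complex.exp (t * fourierForm y s)‖ ≤ C * Real.exp (c * ‖t‖ ^ 2)) :
    ∃ q : MvPolynomial (Fin d) ℂ, q.totalDegree ≤ 2 ∧
      ∀ᵐ x, h x = Complex.exp (MvPolynomial.eval (fun i => (x i : ℂ)) q) := by
  obtain ⟨A, b, hs, hF⟩ := fourier_eq_exp_quadratic hh hne hC
  have hM0 : ∫ s, h s ≠ 0 := by simpa using hne 0 0
  obtain ⟨c, hc, hA⟩ := quadForm_coercive_of_pos fun y hy =>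
    quadForm_re_pos_of_fourier_eq hM0 hF (y := y) hy
  have hFi : Integrable (𝓕 h) := by
    have := ((expIntegrable_cexp_neg_quadForm hc hA).mul_cexp (dotCLM b) 1).integrable.const_mul
      (∫ s, h s)
    refine this.congr (Filter.Eventually.of_forall fun y => ?_)
    simp [hF]
  have hinv := ae_eq_fourierInv_fourier hh.integrable hFi
  set K := (∫ s, h s) * ∫ x, Complex.exp (-quadForm A x) with hK
  -- The inverse transform at `x` is the Laplace transform of the Gaussian at `w = b + 2πi x`.
  have hval (x : EuclideanSpace ℝ (Fin d)) : 𝓕⁻ (𝓕 h) x = K * Complex.exp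
      (MvPolynomial.eval (fun i => (x i : ℂ))
        (shiftedQuadPoly ((1 / 4 : ℂ) • A⁻¹) b (2 * Real.pi * Complex.I))) := by
    rw [eval_shiftedQuadPoly, smul_mulVec, dotProduct_smul, smul_eq_mul, one_div_mul_eq_div, hK,
      mul_assoc, ← integral_gaussian_mul_cexp hs hc hA, ← integral_const_mul, Real.fourierInv_eq']
    refine integral_congr_ae (Filter.Eventually.of_forall fun y => ?_)
    simp only [hF, smul_eq_mul, dotCLM_add, Complex.exp_add]
    have : dotCLM ((2 * Real.pi * Complex.I) • complexCoords x) y =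
        (2 * Real.pi * inner ℝ y x : ℝ) * Complex.I := by
      rw [dotCLM_apply, smul_dotProduct, dotProduct_complexCoords, real_inner_comm]
      push_cast
      simp
      ring
    rw [this]
    ring
  -- Otherwise `h` would vanish almost everywhere. This lets `log K` enter the polynomial as its
  -- constant term.
  have hK0 : K ≠ 0 := by
    intro h0
    refine hM0 ?_
    rw [integral_congr_ae (g := fun _ => 0) (hinv.trans (Filter.Eventually.of_forall fun x => ?_))]
    · simp
    · simp [hval, h0]
  refine ⟨MvPolynomial.C (Complex.log K) +
    shiftedQuadPoly ((1 / 4 : ℂ) • A⁻¹) b (2 * Real.pi * Complex.I), ?_, ?_⟩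
  · refine (MvPolynomial.totalDegree_add _ _).trans (max_le (by simp) ?_)
    exact totalDegree_shiftedQuadPoly_le _ _ _
  · filter_upwards [hinv] with x hx
    rw [hx, hval, map_add, Complex.exp_add, MvPolynomial.eval_C, Complex.exp_log hK0]

end FourierGaussian

/-! ### Gaussian windows, and continuity and sign of the Wigner distribution -/

section Wigner

open FourierTransform
open scoped Convolution

variable {d : ℕ}

/-- Cauchy–Schwarz, as `exp (R ‖s‖) * exp (-a ‖s‖²)` is square-integrable. -/
theorem expIntegrable_mul_gaussian (f : L2 d) {a : ℝ} (ha : 0 < a) :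
    ExpIntegrable (fun s => f s * Complex.exp (-a * ‖s‖ ^ 2)) volume := by
  intro R
  have hg : ExpIntegrable (fun s : EuclideanSpace ℝ (Fin d) =>
      Complex.exp (-(2 * a : ℝ) * ‖s‖ ^ 2)) volume := by
    refine expIntegrable_gaussian (c := 2 * a) (by positivity) (by fun_prop) fun x => ?_
    rw [Complex.norm_exp, ← Complex.ofReal_neg, ← Complex.ofReal_pow, Complex.re_ofReal_mul,
      Complex.ofReal_re]
  have hm : MemLp (fun s : EuclideanSpace ℝ (Fin d) =>
      (Real.exp (R * ‖s‖) : ℂ) * Complex.exp (-a * ‖s‖ ^ 2)) 2 volume := by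
    rw [memLp_two_iff_integrable_sq_norm (by fun_prop)]
    refine (hg (2 * R)).norm.congr (Filter.Eventually.of_forall fun s => ?_)
    simp only [norm_mul, mul_pow, Complex.norm_real, Real.norm_eq_abs, Real.abs_exp,
      Complex.norm_exp, ← Complex.ofReal_neg, ← Complex.ofReal_pow, Complex.re_ofReal_mul,
      Complex.ofReal_re, ← Real.exp_nat_mul]
    congr 2 <;> push_cast <;> ring
  refine ((Lp.memLp f).integrable_mul hm).congr (Filter.Eventually.of_forall fun s => ?_)
  simp only [Pi.mul_apply]
  ring

/-- A function of `L²(ℝᵈ)` multiplied by the standard Gaussian. -/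
noncomputable def gaussianWindow (f : L2 d) (s : EuclideanSpace ℝ (Fin d)) : ℂ :=
  f s * Complex.exp (-Real.pi * ‖s‖ ^ 2)

theorem expIntegrable_gaussianWindow (f : L2 d) : ExpIntegrable (gaussianWindow f) volume :=
  expIntegrable_mul_gaussian f Real.pi_pos

/-- The order-two bound: half of the window keeps `f` integrable, and completing the square with the
other half bounds `exp (‖t‖ ‖l‖ ‖s‖)`. -/
theorem exists_norm_laplace_gaussianWindow_le (f : L2 d) (l : EuclideanSpace ℝ (Fin d) →L[ℝ] ℂ) :
    ∃ C c : ℝ, ∀ t : ℂ, ‖∫ s, gaussianWindow f s * Complex.exp (t * l s)‖ ≤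
      C * Real.exp (c * ‖t‖ ^ 2) := by
  have hpi := Real.pi_pos
  have hi := (expIntegrable_mul_gaussian f (a := Real.pi / 2) (by positivity)).integrable
  refine ⟨∫ s : EuclideanSpace ℝ (Fin d), ‖f s * Complex.exp (-(Real.pi / 2 : ℝ) * ‖s‖ ^ 2)‖,
    ‖l‖ ^ 2 / (2 * Real.pi), fun t => ?_⟩
  rw [← integral_mul_const]
  refine norm_integral_le_of_norm_le (hi.norm.mul_const _) (Filter.Eventually.of_forall fun s => ?_)
  rw [gaussianWindow, norm_mul, norm_mul, norm_mul, mul_assoc, mul_assoc]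
  refine mul_le_mul_of_nonneg_left ?_ (norm_nonneg (f s))
  refine (mul_le_mul_of_nonneg_left (norm_cexp_le_exp_norm l t s)
    (norm_nonneg (Complex.exp (-Real.pi * ‖s‖ ^ 2)))).trans ?_
  simp only [Complex.norm_exp, ← Complex.ofReal_neg, ← Complex.ofReal_pow, Complex.re_ofReal_mul,
    Complex.ofReal_re, ← Real.exp_add, Real.exp_le_exp]
  have h1 : -(Real.pi / 2) * ‖s‖ ^ 2 + ‖l‖ ^ 2 / (2 * Real.pi) * ‖t‖ ^ 2 -
      (-Real.pi * ‖s‖ ^ 2 + ‖t‖ * ‖l‖ * ‖s‖) =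
      (Real.pi * ‖s‖ - ‖l‖ * ‖t‖) ^ 2 / (2 * Real.pi) := by
    field_simp; ring
  have h2 : 0 ≤ (Real.pi * ‖s‖ - ‖l‖ * ‖t‖) ^ 2 / (2 * Real.pi) := by positivity
  linarith

theorem integral_eq_integral_add_half_smul (G : EuclideanSpace ℝ (Fin d) → ℂ)
    (x : EuclideanSpace ℝ (Fin d)) :
    ∫ u, G u = (((1 / 2 : ℝ) ^ d : ℝ) : ℂ) * ∫ t, G (x + (1 / 2 : ℝ) • t) := by
  have h := Measure.integral_comp_smul (volume : Measure (EuclideanSpace ℝ (Fin d)))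
    (fun v => G (x + v)) (1 / 2 : ℝ)
  rw [integral_add_left_eq_self G x] at h
  rw [h, finrank_euclideanSpace, Fintype.card_fin, abs_of_pos (by positivity), Complex.real_smul,
    ← mul_assoc, ← Complex.ofReal_mul, mul_inv_cancel₀ (by positivity), Complex.ofReal_one, one_mul]

theorem memLp_comp_sub_left (g : L2 d) (x : EuclideanSpace ℝ (Fin d)) :
    MemLp (fun u => g (x - u)) 2 volume :=
  (Lp.memLp g).comp_measurePreserving (Measure.measurePreserving_sub_left volume x)

/-- The integrand of the Wigner distribution without its oscillating factor. -/
noncomputable def wignerIntegrand (f g : L2 d) (x t : EuclideanSpace ℝ (Fin d)) : ℂ :=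
  f (x + (1 / 2 : ℝ) • t) * conj (g (x - (1 / 2 : ℝ) • t))

theorem wignerIntegrand_eq (f g : L2 d) (x t : EuclideanSpace ℝ (Fin d)) :
    wignerIntegrand f g x t =
      f (x + (1 / 2 : ℝ) • t) * conj (g ((2 : ℝ) • x - (x + (1 / 2 : ℝ) • t))) := by
  rw [wignerIntegrand, two_smul, add_sub_add_left_eq_sub]

theorem integrable_wignerIntegrand (f g : L2 d) (x : EuclideanSpace ℝ (Fin d)) :
    Integrable (wignerIntegrand f g x) := by
  have h1 : Integrable fun u => f u * conj (g ((2 : ℝ) • x - u)) :=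
    (Lp.memLp f).integrable_mul (memLp_comp_sub_left g _).star
  have h2 := (h1.comp_add_left x).comp_smul (R := (1 / 2 : ℝ)) (by norm_num)
  refine h2.congr (Filter.Eventually.of_forall fun t => ?_)
  simp only [wignerIntegrand_eq]

theorem wigner_eq_fourier (f g : L2 d) (x ξ : EuclideanSpace ℝ (Fin d)) :
    wigner f g x ξ = 𝓕 (wignerIntegrand f g x) ξ := by
  rw [wigner, Real.fourier_eq']
  refine integral_congr_ae (Filter.Eventually.of_forall fun t => ?_)
  simp only [wignerIntegrand, smul_eq_mul]
  rw [mul_comm, real_inner_comm]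
  congr 2
  push_cast
  ring

theorem continuous_wigner_right (f g : L2 d) (x : EuclideanSpace ℝ (Fin d)) :
    Continuous (wigner f g x) := by
  simp_rw [funext (wigner_eq_fourier f g x)]
  exact continuous_fourier_of_integrable (integrable_wignerIntegrand f g x)

/-- After the substitution `u = x + t/2`, this is a constant times the `L²` inner product of `g (2x
- ·)` with `f`, and the reflections `u ↦ 2x - u` act on `g` continuously in `x`. -/
theorem continuous_wigner_zero_right (f g : L2 d) : Continuous fun x => wigner f g x 0 := by
  have hm (x : EuclideanSpace ℝ (Fin d)) :
      MeasurePreserving (fun u : EuclideanSpace ℝ (Fin d) => (2 : ℝ) • x - u) volume volume :=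
    Measure.measurePreserving_sub_left volume _
  let T : EuclideanSpace ℝ (Fin d) → C(EuclideanSpace ℝ (Fin d), EuclideanSpace ℝ (Fin d)) :=
    (ContinuousMap.curry ⟨fun p => (2 : ℝ) • p.1 - p.2, by fun_prop⟩)
  have hT : Continuous T := ContinuousMap.continuous _
  have hcont : Continuous fun x => inner ℂ (Lp.compMeasurePreserving (T x) (hm x) g) f :=
    ((continuous_const (y := g)).compMeasurePreservingLp hT hm (by simp)).inner continuous_const
  refine (hcont.const_mul (((1 / 2 : ℝ) ^ d : ℝ) : ℂ)⁻¹).congr fun x => ?_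
  have h1 : inner ℂ (Lp.compMeasurePreserving (T x) (hm x) g) f =
      ∫ u, f u * conj (g ((2 : ℝ) • x - u)) := by
    rw [L2.inner_def]
    refine integral_congr_ae ?_
    filter_upwards [Lp.coeFn_compMeasurePreserving g (hm x)] with u hu
    have hu' : (Lp.compMeasurePreserving (T x) (hm x) g) u = g ((2 : ℝ) • x - u) := hu
    rw [hu']
    simp
  rw [h1, integral_eq_integral_add_half_smul _ x, inv_mul_cancel_left₀ (by simp)]
  simp only [wigner, inner_zero_left, Complex.ofReal_zero, mul_zero, Complex.exp_zero, mul_one,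
    ← wignerIntegrand_eq, wignerIntegrand]

theorem forall_pos_or_forall_neg_of_ne_zero {X : Type*} [TopologicalSpace X] [PreconnectedSpace X]
    {F : X → ℝ} (hF : Continuous F) (h0 : ∀ x, F x ≠ 0) : (∀ x, 0 < F x) ∨ ∀ x, F x < 0 := by
  by_contra! h
  obtain ⟨⟨a, ha⟩, b, hb⟩ := h
  obtain ⟨x, hx⟩ := mem_range_of_exists_le_of_exists_ge hF ⟨a, ha⟩ ⟨b, hb⟩
  exact h0 x hx

/-- Joint continuity is not needed: the sign is constant in `ξ` for each `x`, and constant in `x` on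
the slice `ξ = 0`. -/
theorem wigner_re_const_mul_sign (f g : L2 d) (c : ℂ) (h : ∀ x ξ, (c * wigner f g x ξ).re ≠ 0) :
    (∀ x ξ, 0 < (c * wigner f g x ξ).re) ∨ ∀ x ξ, 0 < (-c * wigner f g x ξ).re := by
  have hξ (x : EuclideanSpace ℝ (Fin d)) := forall_pos_or_forall_neg_of_ne_zero
    (F := fun ξ => (c * wigner f g x ξ).re)
    (Complex.continuous_re.comp ((continuous_wigner_right f g x).const_mul c)) (h x)
  have hx := forall_pos_or_forall_neg_of_ne_zero (F := fun x => (c * wigner f g x 0).re)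
    (Complex.continuous_re.comp ((continuous_wigner_zero_right f g).const_mul c)) fun x => h x 0
  refine hx.imp (fun hx x ξ => ?_) fun hx x ξ => ?_
  · rcases hξ x with h1 | h1
    · exact h1 ξ
    · exact absurd (h1 0) (hx x).not_gt
  · rw [neg_mul, Complex.neg_re, neg_pos]
    rcases hξ x with h1 | h1
    · exact absurd (h1 0) (hx x).not_gt
    · exact h1 ξ

theorem integral_pos_of_forall_pos {F : EuclideanSpace ℝ (Fin d) → ℝ} (hF : Integrable F)
    (hpos : ∀ x, 0 < F x) : 0 < ∫ x, F x := by
  rw [integral_pos_iff_support_of_nonneg (fun x => (hpos x).le) hF]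
  have : Function.support F = Set.univ := Set.eq_univ_of_forall fun x => (hpos x).ne'
  rw [this]
  exact Measure.measure_univ_pos.2 (NeZero.ne _)

/-- Integrating a Wigner distribution in frequency against a Gaussian. -/
theorem integral_wignerIntegrand_mul_gaussian (f g : L2 d) (x q : EuclideanSpace ℝ (Fin d)) :
    ((((1 / 2 : ℝ) ^ (d / 2 : ℝ) : ℝ)) : ℂ) *
      ∫ t, wignerIntegrand f g x t * Complex.exp (2 * Real.pi * Complex.I * (inner ℝ q t : ℝ)) *
        Complex.exp (-(Real.pi / 2) * ‖t‖ ^ 2) =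
    ∫ ξ, wigner f g x (ξ - q) * Complex.exp (-(2 * Real.pi : ℝ) * ‖ξ‖ ^ 2) := by
  set k := fun t => wignerIntegrand f g x t *
    Complex.exp (2 * Real.pi * Complex.I * (inner ℝ q t : ℝ)) with hk
  have hki : Integrable k := by
    have hm : Continuous fun t : EuclideanSpace ℝ (Fin d) =>
      Complex.exp (2 * Real.pi * Complex.I * (inner ℝ q t : ℝ)) := by fun_prop
    refine (integrable_wignerIntegrand f g x).mul_bdd (c := 1) hm.aestronglyMeasurable
      (Filter.Eventually.of_forall fun t => ?_)
    simp [Complex.norm_exp]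
  have hkF (ξ : EuclideanSpace ℝ (Fin d)) : 𝓕 k ξ = wigner f g x (ξ - q) := by
    rw [wigner_eq_fourier, Real.fourier_eq', Real.fourier_eq']
    refine integral_congr_ae (Filter.Eventually.of_forall fun t => ?_)
    simp only [hk, smul_eq_mul, inner_sub_right, real_inner_comm t q]
    rw [mul_comm (wignerIntegrand f g x t), ← mul_assoc, ← Complex.exp_add]
    congr 2
    push_cast
    ring
  have hpi := Real.pi_pos
  have hg : Integrable fun ξ : EuclideanSpace ℝ (Fin d) =>
      Complex.exp (-(2 * Real.pi : ℝ) * ‖ξ‖ ^ 2) := by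
    simpa using GaussianFourier.integrable_cexp_neg_mul_sq_norm_add
      (V := EuclideanSpace ℝ (Fin d)) (b := ((2 * Real.pi : ℝ) : ℂ))
      (by rw [Complex.ofReal_re]; positivity) 0 0
  simp_rw [← hkF]
  -- The transform moves onto the Gaussian: that of `exp (-2π‖ξ‖²)` is `2^(-d/2) exp (-(π/2)‖t‖²)`,
  -- the factor produced by two windows at `x ± t/2`.
  rw [integral_fourier_mul_of_integrable hki hg, ← integral_const_mul]
  refine integral_congr_ae (Filter.Eventually.of_forall fun t => ?_)
  simp only
  rw [fourier_gaussian_innerProductSpace (by rw [Complex.ofReal_re]; positivity),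
    finrank_euclideanSpace, Fintype.card_fin, Complex.ofReal_cpow (by positivity)]
  have h1 : (Real.pi : ℂ) / (2 * Real.pi : ℝ) = (1 / 2 : ℝ) := by
    push_cast
    field_simp
  have h2 : -(Real.pi : ℂ) ^ 2 * ‖t‖ ^ 2 / (2 * Real.pi : ℝ) = -(Real.pi / 2) * ‖t‖ ^ 2 := by
    push_cast
    field_simp
  rw [h1, h2]
  push_cast
  ring

end Wigner

/-! ### Positivity for Bargmann transforms and its consequences -/

section Positivity

open FourierTransform
open scoped Convolution

variable {d : ℕ}

/-- The exponent of a Gabor–Bargmann coherent state. -/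
noncomputable def coherentForm (p q : EuclideanSpace ℝ (Fin d)) : EuclideanSpace ℝ (Fin d) →L[ℝ] ℂ :=
  dotCLM ((2 * Real.pi : ℂ) • complexCoords p + (2 * Real.pi * Complex.I) • complexCoords q)

theorem coherentForm_apply (p q s : EuclideanSpace ℝ (Fin d)) :
    coherentForm p q s = 2 * Real.pi * (inner ℝ p s : ℝ) +
      2 * Real.pi * Complex.I * (inner ℝ q s : ℝ) := by
  rw [coherentForm, dotCLM_add, dotCLM_apply, dotCLM_apply, smul_dotProduct, smul_dotProduct,
    dotProduct_complexCoords, dotProduct_complexCoords, smul_eq_mul, smul_eq_mul]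

/-- By the parallelogram law the two windows split into a function of `x` and one of `t`.
Conjugation leaves `p` acting only on the midpoint `x` and `q` only on the difference `t`, where it
is a frequency shift. -/
theorem gaussianWindow_mul_conj_gaussianWindow (f g : L2 d)
    (p q x t : EuclideanSpace ℝ (Fin d)) :
    gaussianWindow f (x + (1 / 2 : ℝ) • t) *
        Complex.exp (coherentForm p q (x + (1 / 2 : ℝ) • t)) *
      conj (gaussianWindow g (x - (1 / 2 : ℝ) • t) *
        Complex.exp (coherentForm p q (x - (1 / 2 : ℝ) • t))) =
    (Real.exp (-(2 * Real.pi) * ‖x‖ ^ 2 + 4 * Real.pi * inner ℝ p x) : ℂ) *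
      (wignerIntegrand f g x t * Complex.exp (2 * Real.pi * Complex.I * (inner ℝ q t : ℝ)) *
        Complex.exp (-(Real.pi / 2) * ‖t‖ ^ 2)) := by
  have hadd := norm_add_sq_real x ((1 / 2 : ℝ) • t)
  have hsub := norm_sub_sq_real x ((1 / 2 : ℝ) • t)
  simp only [gaussianWindow, wignerIntegrand, map_mul, ← Complex.exp_conj, coherentForm_apply]
  have h1 : (‖x + (1 / 2 : ℝ) • t‖ : ℂ) ^ 2 + (‖x - (1 / 2 : ℝ) • t‖ : ℂ) ^ 2 =
      2 * ‖x‖ ^ 2 + ‖t‖ ^ 2 / 2 := by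
    have : ‖x + (1 / 2 : ℝ) • t‖ ^ 2 + ‖x - (1 / 2 : ℝ) • t‖ ^ 2 =
        2 * ‖x‖ ^ 2 + ‖t‖ ^ 2 / 2 := by
      rw [hadd, hsub, norm_smul, Real.norm_of_nonneg (by norm_num)]
      ring
    exact_mod_cast this
  have h2 : ∀ a b e₁ e₂ e₃ e₄ : ℂ, a * Complex.exp e₁ * Complex.exp e₂ *
      (b * Complex.exp e₃ * Complex.exp e₄) = a * b * Complex.exp (e₁ + e₂ + e₃ + e₄) := by
    intro a b e₁ e₂ e₃ e₄
    simp only [Complex.exp_add]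
    ring
  have h3 : ∀ e₁ a e₂ e₃ : ℂ, Complex.exp e₁ * (a * Complex.exp e₂ * Complex.exp e₃) =
      a * Complex.exp (e₁ + e₂ + e₃) := by
    intro e₁ a e₂ e₃
    simp only [Complex.exp_add]
    ring
  rw [h2, Complex.ofReal_exp, h3]
  congr 2
  simp only [map_add, map_mul, map_neg, map_pow, Complex.conj_ofReal, Complex.conj_I, map_ofNat,
    inner_add_right, inner_sub_right, inner_smul_right]
  push_cast
  linear_combination (-(Real.pi : ℂ)) * h1

/-- A convolution evaluated at `2x`, since the arguments `x ± t/2` sum to `2x`. Of the prefactor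
only its being real and positive matters later. -/
theorem convolution_gaussianWindow (f g : L2 d) (p q x : EuclideanSpace ℝ (Fin d)) :
    ∫ u, gaussianWindow f u * Complex.exp (coherentForm p q u) *
        conj (gaussianWindow g ((2 : ℝ) • x - u) *
          Complex.exp (coherentForm p q ((2 : ℝ) • x - u))) =
    (((1 / 2 : ℝ) ^ d * Real.exp (-(2 * Real.pi) * ‖x‖ ^ 2 + 4 * Real.pi * inner ℝ p x) *
        ((1 / 2 : ℝ) ^ (d / 2 : ℝ))⁻¹ : ℝ) : ℂ) *
      ∫ ξ, wigner f g x (ξ - q) * Complex.exp (-(2 * Real.pi : ℝ) * ‖ξ‖ ^ 2) := by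
  have hsub (t : EuclideanSpace ℝ (Fin d)) :
      (2 : ℝ) • x - (x + (1 / 2 : ℝ) • t) = x - (1 / 2 : ℝ) • t := by
    rw [two_smul, add_sub_add_left_eq_sub]
  have hc : (((1 / 2 : ℝ) ^ (d / 2 : ℝ) : ℝ) : ℂ) ≠ 0 :=
    Complex.ofReal_ne_zero.2 (by positivity)
  rw [integral_eq_integral_add_half_smul _ x, ← integral_wignerIntegrand_mul_gaussian]
  simp only [hsub, gaussianWindow_mul_conj_gaussianWindow, integral_const_mul]
  rw [Complex.ofReal_mul, Complex.ofReal_mul, Complex.ofReal_inv]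
  field_simp

theorem re_integral_wigner_mul_gaussian_pos {f g : L2 d} {c : ℂ}
    (hpos : ∀ x ξ, 0 < (c * wigner f g x ξ).re) (x q : EuclideanSpace ℝ (Fin d)) :
    0 < (c * ∫ ξ, wigner f g x (ξ - q) * Complex.exp (-(2 * Real.pi : ℝ) * ‖ξ‖ ^ 2)).re := by
  have hpi := Real.pi_pos
  have hg : Integrable fun ξ : EuclideanSpace ℝ (Fin d) =>
      Complex.exp (-(2 * Real.pi : ℝ) * ‖ξ‖ ^ 2) := by
    simpa using GaussianFourier.integrable_cexp_neg_mul_sq_norm_add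
      (V := EuclideanSpace ℝ (Fin d)) (b := ((2 * Real.pi : ℝ) : ℂ))
      (by rw [Complex.ofReal_re]; positivity) 0 0
  have hW : Continuous fun ξ => wigner f g x (ξ - q) :=
    (continuous_wigner_right f g x).comp (continuous_id.sub continuous_const)
  have hi : Integrable fun ξ => wigner f g x (ξ - q) *
      Complex.exp (-(2 * Real.pi : ℝ) * ‖ξ‖ ^ 2) := by
    refine hg.bdd_mul (c := ∫ t, ‖wignerIntegrand f g x t‖) hW.aestronglyMeasurable
      (Filter.Eventually.of_forall fun ξ => ?_)
    rw [wigner_eq_fourier]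
    exact VectorFourier.norm_fourierIntegral_le_integral_norm _ _ _ _ _
  rw [← integral_const_mul]
  have hre : (∫ ξ, c * (wigner f g x (ξ - q) * Complex.exp (-(2 * Real.pi : ℝ) * ‖ξ‖ ^ 2))).re =
      ∫ ξ, (c * (wigner f g x (ξ - q) * Complex.exp (-(2 * Real.pi : ℝ) * ‖ξ‖ ^ 2))).re :=
    (integral_re (hi.const_mul c)).symm
  rw [hre]
  refine integral_pos_of_forall_pos (hi.const_mul c).re fun ξ => ?_
  have : Complex.exp (-(2 * Real.pi : ℝ) * ‖ξ‖ ^ 2) =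
      (Real.exp (-(2 * Real.pi) * ‖ξ‖ ^ 2) : ℝ) := by push_cast; rfl
  rw [this, ← mul_assoc, mul_comm, Complex.re_ofReal_mul]
  exact mul_pos (Real.exp_pos _) (hpos x _)

/-- Positivity of `Re (c W(f,g))` passes to the products of Bargmann transforms. -/
theorem re_bargmann_mul_conj_bargmann_pos {f g : L2 d} {c : ℂ}
    (hpos : ∀ x ξ, 0 < (c * wigner f g x ξ).re) (p q : EuclideanSpace ℝ (Fin d)) :
    0 < (c * ((∫ s, gaussianWindow f s * Complex.exp (coherentForm p q s)) *
      conj (∫ s, gaussianWindow g s * Complex.exp (coherentForm p q s)))).re := by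
  have hint (f : L2 d) : Integrable fun s =>
      gaussianWindow f s * Complex.exp (coherentForm p q s) := by
    simpa using ((expIntegrable_gaussianWindow f).mul_cexp (coherentForm p q) 1).integrable
  set Φ := fun s => gaussianWindow f s * Complex.exp (coherentForm p q s) with hΦ
  set Ψ := fun s => conj (gaussianWindow g s * Complex.exp (coherentForm p q s)) with hΨ
  have hΦi : Integrable Φ := hint f
  have hΨi : Integrable Ψ := (Complex.conjCLE : ℂ →L[ℝ] ℂ).integrable_comp (hint g)
  -- The product of the two integrals is the integral of the convolution, whose value at each `y` is
  -- a positive multiple of a Gaussian average of `W(f,g)` at position `y/2`.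
  have hconv := integral_convolution (μ := (volume : Measure (EuclideanSpace ℝ (Fin d))))
    (ν := volume) (ContinuousLinearMap.mul ℝ ℂ) hΦi hΨi
  have hconvi := hΦi.integrable_convolution (ContinuousLinearMap.mul ℝ ℂ) hΨi
  rw [ContinuousLinearMap.mul_apply'] at hconv
  rw [← integral_conj, ← hconv, ← integral_const_mul]
  have hre : (∫ y, c * (Φ ⋆[ContinuousLinearMap.mul ℝ ℂ, volume] Ψ) y).re =
      ∫ y, (c * (Φ ⋆[ContinuousLinearMap.mul ℝ ℂ, volume] Ψ) y).re :=
    (integral_re (hconvi.const_mul c)).symm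
  rw [hre]
  refine integral_pos_of_forall_pos (hconvi.const_mul c).re fun y => ?_
  have hy : (2 : ℝ) • ((1 / 2 : ℝ) • y) = y := by rw [smul_smul]; norm_num
  have hval := convolution_gaussianWindow f g p q ((1 / 2 : ℝ) • y)
  rw [hy] at hval
  have hdef : (Φ ⋆[ContinuousLinearMap.mul ℝ ℂ, volume] Ψ) y = ∫ u, Φ u * Ψ (y - u) := rfl
  rw [hdef, hval, mul_left_comm, Complex.re_ofReal_mul]
  exact mul_pos (by positivity) (re_integral_wigner_mul_gaussian_pos hpos _ _)

/-- Points of a complexified line are real phase-space points, so positivity over all `p`, `q`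
controls the transform at every complex `t`. -/
theorem mul_fourierForm_eq_coherentForm (y s : EuclideanSpace ℝ (Fin d)) (t : ℂ) :
    t * fourierForm y s = coherentForm (t.im • y) (-(t.re • y)) s := by
  rw [fourierForm_apply, coherentForm_apply, inner_neg_left, inner_smul_left, inner_smul_left]
  simp only [conj_trivial, Complex.ofReal_neg, Complex.ofReal_mul]
  linear_combination (2 * Real.pi * Complex.I * (inner ℝ y s : ℝ)) * Complex.re_add_im t +
    (-2 * (t.im : ℂ) * Real.pi * (inner ℝ y s : ℝ)) * Complex.I_mul_I

theorem re_laplace_mul_conj_laplace_pos {f g : L2 d} {c : ℂ}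
    (hpos : ∀ x ξ, 0 < (c * wigner f g x ξ).re) (y : EuclideanSpace ℝ (Fin d)) (t : ℂ) :
    0 < (c * ((∫ s, gaussianWindow f s * Complex.exp (t * fourierForm y s)) *
      conj (∫ s, gaussianWindow g s * Complex.exp (t * fourierForm y s)))).re := by
  simp only [mul_fourierForm_eq_coherentForm]
  exact re_bargmann_mul_conj_bargmann_pos hpos _ _

theorem isGeneralizedGaussian_of_laplace_ne_zero {f : L2 d}
    (h : ∀ y (t : ℂ), ∫ s, gaussianWindow f s * Complex.exp (t * fourierForm y s) ≠ 0) :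
    IsGeneralizedGaussian f := by
  obtain ⟨q, hq, hae⟩ := exists_ae_eq_exp_quadratic (expIntegrable_gaussianWindow f) h
    fun y => exists_norm_laplace_gaussianWindow_le f (fourierForm y)
  -- The second term is `π‖x‖²`, which undoes the window.
  refine ⟨-q - shiftedQuadPoly (Matrix.diagonal fun _ => (Real.pi : ℂ)) 0 1, ?_, ?_⟩
  · refine (MvPolynomial.totalDegree_sub _ _).trans (max_le ?_ ?_)
    · rwa [MvPolynomial.totalDegree_neg]
    · exact totalDegree_shiftedQuadPoly_le _ _ _
  · filter_upwards [hae] with x hx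
    have h1 : MvPolynomial.eval (fun i => (x i : ℂ))
        (shiftedQuadPoly (Matrix.diagonal fun _ => (Real.pi : ℂ)) 0 1) = Real.pi * ‖x‖ ^ 2 := by
      rw [eval_shiftedQuadPoly, zero_add, one_smul]
      have h2 : (Matrix.diagonal fun _ : Fin d => (Real.pi : ℂ)).mulVec (complexCoords x) =
          (Real.pi : ℂ) • complexCoords x := by
        ext i
        simp [Matrix.mulVec_diagonal]
      rw [h2, dotProduct_smul, dotProduct_complexCoords, real_inner_self_eq_norm_sq,
        smul_eq_mul, Complex.ofReal_pow]
    rw [map_sub, map_neg, h1, neg_sub, sub_neg_eq_add, Complex.exp_add, ← hx, gaussianWindow,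
      mul_left_comm, ← Complex.exp_add]
    simp

/-- If `Re (c W(f,g))` is positive, then `f` and `g` are proportional generalized Gaussians. -/
theorem isGeneralizedGaussian_of_wigner_re_pos {f g : L2 d} {c : ℂ}
    (hpos : ∀ x ξ, 0 < (c * wigner f g x ξ).re) :
    IsGeneralizedGaussian f ∧ IsGeneralizedGaussian g ∧ ∃ b : ℂ, g = b • f := by
  set F := fun (y : EuclideanSpace ℝ (Fin d)) (t : ℂ) =>
    ∫ s, gaussianWindow f s * Complex.exp (t * fourierForm y s) with hF
  set G := fun (y : EuclideanSpace ℝ (Fin d)) (t : ℂ) =>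
    ∫ s, gaussianWindow g s * Complex.exp (t * fourierForm y s) with hG
  have hFG (y : EuclideanSpace ℝ (Fin d)) (t : ℂ) : 0 < (c * (F y t * conj (G y t))).re :=
    re_laplace_mul_conj_laplace_pos hpos y t
  have hF0 (y : EuclideanSpace ℝ (Fin d)) (t : ℂ) : F y t ≠ 0 := fun h => by
    simpa [h] using hFG y t
  have hG0 (y : EuclideanSpace ℝ (Fin d)) (t : ℂ) : G y t ≠ 0 := fun h => by
    simpa [h] using hFG y t
  have hc : c ≠ 0 := fun h => by simpa [h] using hFG 0 0
  refine ⟨isGeneralizedGaussian_of_laplace_ne_zero hF0, isGeneralizedGaussian_of_laplace_ne_zero hG0,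
    ?_⟩
  -- Liouville on the line through `y` compares `t = 1` with `t = 0`, where the value no longer
  -- depends on `y`.
  have hconst (y : EuclideanSpace ℝ (Fin d)) : F y 1 / G y 1 = F 0 0 / G 0 0 := by
    have h0 (f : L2 d) : ∫ s, gaussianWindow f s * Complex.exp ((0 : ℂ) * fourierForm y s) =
        ∫ s, gaussianWindow f s * Complex.exp ((0 : ℂ) * fourierForm 0 s) := by simp
    have hd : Differentiable ℂ fun t => c * (F y t / G y t) := fun t =>
      (((expIntegrable_gaussianWindow f).hasDerivAt_integral (fourierForm y) t).differentiableAt.div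
        ((expIntegrable_gaussianWindow g).hasDerivAt_integral (fourierForm y) t).differentiableAt
        (hG0 y t)).const_mul c
    have := entire_apply_eq_of_re_pos hd (fun t => ?_) 1 0
    · have h2 := mul_left_cancel₀ hc this
      rw [h2, hF, hG]
      simp only [h0]
    · have h3 : c * (F y t / G y t) =
          ((Complex.normSq (G y t))⁻¹ : ℝ) * (c * (F y t * conj (G y t))) := by
        rw [div_eq_mul_inv, Complex.inv_def, Complex.ofReal_inv]
        ring
      rw [h3, Complex.re_ofReal_mul]
      exact mul_pos (inv_pos.2 (Complex.normSq_pos.2 (hG0 y t))) (hFG y t)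
  set b := G 0 0 / F 0 0 with hb
  refine ⟨b, ?_⟩
  have hGF (y : EuclideanSpace ℝ (Fin d)) : G y 1 = b * F y 1 := by
    have := hconst y
    rw [div_eq_div_iff (hG0 y 1) (hG0 0 0)] at this
    rw [hb, div_mul_eq_mul_div, eq_div_iff (hF0 0 0)]
    linear_combination -this
  have hfi := (expIntegrable_gaussianWindow f).integrable
  have hgi := (expIntegrable_gaussianWindow g).integrable
  set k := fun s => gaussianWindow g s - b * gaussianWindow f s with hk
  have hki : Integrable k := hgi.sub (hfi.const_mul b)
  -- At `t = 1` the functions `F y` and `G y` take the values at `y` of the Fourier transforms of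
  -- the windowed `f` and `g`.
  have hkF : 𝓕 k = 0 := by
    ext y
    have h1 := hGF y
    simp only [hF, hG, one_mul] at h1
    rw [fourier_eq_integral_fourierForm]
    simp only [hk, sub_mul]
    have i1 (f : L2 d) : Integrable fun s =>
        gaussianWindow f s * Complex.exp (fourierForm y s) := by
      simpa using ((expIntegrable_gaussianWindow f).mul_cexp (fourierForm y) 1).integrable
    have i2 : Integrable fun s => b * gaussianWindow f s * Complex.exp (fourierForm y s) := by
      simpa only [mul_assoc] using (i1 f).const_mul b
    rw [integral_sub (i1 g) i2, h1]
    simp only [mul_assoc, integral_const_mul, sub_self, Pi.zero_apply]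
  have hk0 := ae_eq_fourierInv_fourier hki (by rw [hkF]; exact integrable_zero _ _ _)
  refine Lp.ext ?_
  filter_upwards [hk0, Lp.coeFn_smul b f] with x hx hbx
  rw [hkF] at hx
  have hx' : k x = 0 := by
    rw [hx, Real.fourierInv_eq]
    simp
  rw [hbx, Pi.smul_apply, smul_eq_mul]
  have he := Complex.exp_ne_zero (-Real.pi * ‖x‖ ^ 2)
  refine mul_right_cancel₀ he ?_
  simp only [hk, gaussianWindow] at hx'
  linear_combination hx'

end Positivity

/-! ### The theorem -/

theorem mainTheorem3 (d : ℕ) (f g : L2 d) :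
    ((∀ x ξ : EuclideanSpace ℝ (Fin d), (wigner f g x ξ).re ≠ 0) →
      ∃ γ : L2 d, IsGeneralizedGaussian γ ∧ ∃ a b : ℂ, f = a • γ ∧ g = b • γ) ∧
    ((∀ x ξ : EuclideanSpace ℝ (Fin d), (wigner f g x ξ).im ≠ 0) →
      IsGeneralizedGaussian f ∧ IsGeneralizedGaussian g) := by
  have key (c : ℂ) (h : ∀ x ξ, (c * wigner f g x ξ).re ≠ 0) :
      IsGeneralizedGaussian f ∧ IsGeneralizedGaussian g ∧ ∃ b : ℂ, g = b • f := by
    rcases wigner_re_const_mul_sign f g c h with hpos | hpos <;>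
      exact isGeneralizedGaussian_of_wigner_re_pos hpos
  refine ⟨fun h => ?_, fun h => ?_⟩
  · obtain ⟨hf, -, b, hb⟩ := key 1 (by simpa using h)
    exact ⟨f, hf, 1, b, (one_smul ℂ f).symm, hb⟩
  -- `Re (-i W) = Im W`.
  · obtain ⟨hf, hg, -⟩ := key (-Complex.I) (by simpa using h)
    exact ⟨hf, hg⟩
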